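/- Theorem (parameter derivative of the regularized Kummer function). Let $a\ge 1$. For real $\nu,x$ let $$\frac{{}_1F_1(a;\nu;x)}{\Gamma(\nu)}:=\sum_{k=0}^{\infty}\frac{(a)_k}{k!\,\Gamma(\nu+k)}x^k\qquad(1/\Gamma=0\text{ at the poles of }\Gamma),\qquad h(\nu,x):=\frac{\partial}{\partial a}\frac{{}_1F_1(a;\nu;x)}{\Gamma(\nu)},$$ $$\lambda_{\beta,\nu}(x):=h(\nu+1,x)h(\nu+\beta,x)-h(\nu,x)h(\nu+\beta+1,x).$$ Here $(a)_k=a(a+1)\cdots(a+k-1)$ and $\psi=\Gamma'/\Gamma$; put $h_k:=(\psi(a+k)-\psi(a))(a)_k/k!$. Then: (0) The derivative exists for all real $\nu,x$, and $h(\nu,x)=\sum_{k\ge0}\frac{h_k}{\Gamma(\nu+k)}x^k$. The function $y\mapsto\psi(a+y)-\psi(a)$ is concave on $[0,\infty)$. We have $h_0=0$, $h_k>0$ for $k\ge1$, and $h_k^2>h_{k-1}h_{k+1}$ for all $k\ge1$. (1) For each $x>0$ the function $\nu\mapsto h(\nu,x)$ is positive and strictly discrete Wright log-concave on $(0,\infty)$,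 that is, $h(\nu+n,x)h(\nu+s,x)>h(\nu,x)h(\nu+n+s,x)$ for all $\nu>0$, $s>0$ and integers $n\ge1$. Let moreover $\nu\ge-1$, $\beta>0$ and $\nu+\beta\ge0$. Then: (2) $\lambda_{\beta,\nu}(x)=\sum_{m\ge0}\lambda_mx^m$ for all real $x$, where $\lambda_0=\lambda_1=0$ and $\lambda_m>0$ for all $m\ge2$. The function $\lambda_{\beta,\nu}$ is absolutely monotonic (it is smooth and all its derivatives are non-negative) and positive and multiplicatively convex on $(0,\infty)$, that is, $\lambda_{\beta,\nu}(x^ty^{1-t})\le\lambda_{\beta,\nu}(x)^t\lambda_{\beta,\nu}(y)^{1-t}$ for $x,y>0$, $t\in[0,1]$. (3) The function $y\mapsto\lambda_{\beta,\nu}(1/y)$ is completely monotonic and log-convex on $(0,\infty)$, and there is a non-negative measure $\tau$ supported on $[0,\infty)$ such that $\lambda_{\beta,\nu}(x)=\int_{[0,\infty)}e^{-t/x}\,d\tau(t)$ for all $x>0$, the integral being finite. (4) For all $x>0$ we have $h(1+\nu,x)h(\beta+\nu,x)>0$ and $$\frac{\nu}{\beta+\nu}<\frac{h(\nu,x)\,h(1+\beta+\nu,x)}{h(1+\nu,x)\,h(\beta+\nu,x)}<1,$$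 where for $\beta+\nu=0$ (which forces $\nu<0$) the left-hand side is read as $-\infty$. (5) For all $x\ge0$, $$\lambda_{\beta,\nu}(x)\ge\frac{h_0^2\,\beta}{\Gamma(\nu+1)\Gamma(\nu+\beta+1)}\;(=0),$$ with equality if and only if $x=0$. -/

import Mathlib

open Set MeasureTheory

namespace RegKummer

noncomputable section

/-- Kummer's function `₁F₁(a; ν; x) = ∑ (a)_k / ((ν)_k k!) x^k`
(meaningful when `ν` is not a non-positive integer). -/
def kummer (a ν x : ℝ) : ℝ :=
  ∑' k : ℕ, (ascPochhammer ℝ k).eval a / ((ascPochhammer ℝ k).eval ν * k.factorial) * x ^ k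

/-- The regularized Kummer function `₁F₁(a; ν; x) / Γ(ν)`, defined for every real `ν` by the series
`∑ (a)_k / (k! Γ(ν + k)) x^k`.  A term with `ν + k` a pole of `Γ` vanishes: Mathlib's `Γ` is zero
there and division by zero is zero, which is the usual convention `1 / Γ = 0` at the poles. -/
def regKummer (a ν x : ℝ) : ℝ :=
  ∑' k : ℕ, (ascPochhammer ℝ k).eval a / (k.factorial * Real.Gamma (ν + k)) * x ^ k

/-- `regKummer` is Mathlib's regularized hypergeometric function with one upper and one lower
parameter. -/
theorem regKummer_eq_regularizedHGFun (a ν x : ℝ) :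
    (regKummer a ν x : ℂ) = Complex.regularizedHGFun {(a : ℂ)} {(ν : ℂ)} (x : ℂ) := by
  have h (k : ℕ) : (((ascPochhammer ℝ k).eval a : ℝ) : ℂ) = (ascPochhammer ℂ k).eval (a : ℂ) := by
    rw [← ascPochhammer_map Complex.ofRealHom, Polynomial.eval_map, ← Complex.ofRealHom_eq_coe,
      ← Complex.ofRealHom_eq_coe, Polynomial.eval₂_hom]
  rw [regKummer, Complex.regularizedHGFun, Complex.regularizedHGFunSeries,
    FormalMultilinearSeries.sum, Complex.ofReal_tsum]
  refine tsum_congr fun k => ?_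
  have hG : Complex.Gamma ((ν : ℂ) + (k : ℂ)) = ((Real.Gamma (ν + k) : ℝ) : ℂ) := by
    rw [← Complex.Gamma_ofReal]
    push_cast
    rfl
  rw [FormalMultilinearSeries.ofScalars_apply_eq]
  simp [Complex.regularizedHGFunCoeff, h, hG]

/-- Where the denominators do not vanish, `regKummer` is the quotient `₁F₁(a; ν; x) / Γ(ν)`. -/
theorem regKummer_eq_kummer_div_Gamma (a ν x : ℝ) (hν : ∀ n : ℕ, ν ≠ -n) :
    regKummer a ν x = kummer a ν x / Real.Gamma ν := by
  have key (k : ℕ) :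
      Real.Gamma (ν + k) = (ascPochhammer ℝ k).eval ν * Real.Gamma ν := by
    induction k with
    | zero => simp
    | succ k ih =>
      have h0 : ν + k ≠ 0 := fun h => hν k (by linarith)
      rw [Nat.cast_succ, ← add_assoc, Real.Gamma_add_one h0, ih, ascPochhammer_succ_eval]
      ring
  rw [regKummer, kummer, ← tsum_div_const]
  refine tsum_congr fun k => ?_
  rw [key k, div_mul_eq_mul_div, div_mul_eq_mul_div, div_div]
  congr 1
  ring

/-- The parameter derivative `h(ν, x) = ∂/∂a [₁F₁(a; ν; x) / Γ(ν)]`. -/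
def paramDeriv (a ν x : ℝ) : ℝ :=
  deriv (fun α : ℝ => regKummer α ν x) a

/-- The digamma function `ψ = Γ' / Γ` on the reals. -/
def digamma (x : ℝ) : ℝ := logDeriv Real.Gamma x

/-- `h_k = (ψ(a + k) - ψ(a)) (a)_k / k!`. -/
def coeff (a : ℝ) (k : ℕ) : ℝ :=
  (digamma (a + k) - digamma a) * (ascPochhammer ℝ k).eval a / k.factorial

/-- `λ_{β,ν}(x) = h(ν+1, x) h(ν+β, x) - h(ν, x) h(ν+β+1, x)`. -/
def lam (a β ν x : ℝ) : ℝ :=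
  paramDeriv a (ν + 1) x * paramDeriv a (ν + β) x
    - paramDeriv a ν x * paramDeriv a (ν + β + 1) x

/-- Strict discrete Wright log-concavity of a positive function on `s`: for each integer shift
`n ≥ 1` and each real shift `r > 0`, `f(μ) f(μ+n+r) < f(μ+n) f(μ+r)`, all arguments in `s`. -/
def StrictDiscreteWrightLogConcaveOn (f : ℝ → ℝ) (s : Set ℝ) : Prop :=
  (∀ μ ∈ s, 0 < f μ) ∧
    ∀ (n : ℕ) (r μ : ℝ), 1 ≤ n → 0 < r → μ ∈ s → μ + n ∈ s → μ + r ∈ s → μ + n + r ∈ s →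
      f μ * f (μ + n + r) < f (μ + n) * f (μ + r)

/-- Multiplicative convexity of a positive function on `(0, ∞)`. -/
def MultiplicativelyConvex (f : ℝ → ℝ) : Prop :=
  (∀ x, 0 < x → 0 < f x) ∧
    ∀ x y t : ℝ, 0 < x → 0 < y → 0 ≤ t → t ≤ 1 →
      f (x ^ t * y ^ (1 - t)) ≤ f x ^ t * f y ^ (1 - t)

/-- Complete monotonicity on an open set `s` (used for `(0, ∞)`). -/
def CompletelyMonotoneOn (f : ℝ → ℝ) (s : Set ℝ) : Prop :=
  ContDiffOn ℝ (⊤ : ℕ∞) f s ∧ ∀ n : ℕ, ∀ x ∈ s, 0 ≤ (-1) ^ n * iteratedDerivWithin n f s x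

/-- Log-convexity of a positive function on `s`. -/
def LogConvexOn (f : ℝ → ℝ) (s : Set ℝ) : Prop :=
  (∀ x ∈ s, 0 < f x) ∧ ConvexOn ℝ s (fun x => Real.log (f x))

end

end RegKummer

/-! Differentiating the series in `a` term by term gives `h(ν, x) = ∑ h_k x^k / Γ(ν + k)`, because
the logarithmic derivative of `(a)_k` is `∑_{i<k} 1/(a+i) = ψ(a+k) - ψ(a)`. Put `u_k = 1/Γ(ν+k)` and
`v_k = 1/Γ(ν+β+k)`; raising the parameter by one shifts the index of these weights.

After a Cauchy product and reindexing, the `m`-th coefficient of `λ` is a sum over `p + q = m + 1`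
of `D(p,q) u_p v_q`, where `D(p,q) = h_{p-1} h_q - h_p h_{q-1}` is antisymmetric. Symmetrising turns
twice that coefficient into `∑ D(p,q) (u_p v_q - u_q v_p)`. For `1 ≤ p < q` both factors are
negative: the first by log-concavity of `h_k` (`coeff_mul_coeff_lt`), the second by monotonicity of
a ratio of Gamma values (`inv_Gamma_mul_inv_Gamma_lt`). Terms with `p = 0` or `q = 0` drop out since
`h_0 = 0`, which lets `ν` go down to `-1`. This is `sum_antidiagonal_shift_sub_pos`.

Absolute and complete monotonicity, both convexity claims and the Laplace representation hold for
any entire series with nonnegative coefficients (not all zero for the convexity claims, zero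
constant term for the Laplace representation). The lower bound on the quotient comes from a second
symmetrisation, `mul_paramDeriv_mul_paramDeriv_lt`. -/

namespace RegKummer

/-! ### Entire power series with nonnegative coefficients -/

section EntireSeries

theorem hasSum_of_eq {u v : ℕ → ℝ} {s : ℝ} (huv : ∀ m, u m = v m) (h : HasSum u s) :
    HasSum v s :=
  funext huv ▸ h

variable {c : ℕ → ℝ} {f : ℝ → ℝ}

/-- An everywhere convergent real power series may be differentiated term by term. -/
theorem exists_hasDerivAt_of_hasSum_pow (hf : ∀ x, HasSum (fun m => c m * x ^ m) (f x)) :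
    ∃ g : ℝ → ℝ, (∀ x, HasDerivAt f (g x) x) ∧
      ∀ x, HasSum (fun m : ℕ => ((m : ℝ) + 1) * c (m + 1) * x ^ m) (g x) := by
  -- Majorant for the differentiated series on `|y| < R`: `m < 2^m` absorbs the factor `m`, and `R +
  -- 1 ≥ 1` absorbs the missing power.
  have bound (R : ℝ) (hR : 0 < R) (m : ℕ) (y : ℝ) (hy : |y| < R) :
      ‖c m * (m * y ^ (m - 1))‖ ≤ ‖c m * (2 * (R + 1)) ^ m‖ := by
    rw [norm_mul, norm_mul (c m)]
    refine mul_le_mul_of_nonneg_left ?_ (norm_nonneg (c m))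
    rw [norm_mul, norm_pow, norm_pow, Real.norm_natCast, Real.norm_eq_abs, Real.norm_eq_abs,
      abs_of_pos (by positivity : 0 < 2 * (R + 1)), mul_pow]
    gcongr
    · exact_mod_cast Nat.lt_two_pow_self.le
    · calc |y| ^ (m - 1) ≤ (R + 1) ^ (m - 1) := by gcongr; linarith
        _ ≤ (R + 1) ^ m := pow_le_pow_right₀ (by linarith) (Nat.sub_le _ _)
  have summ (x : ℝ) : Summable fun m : ℕ => c m * (m * x ^ (m - 1)) :=
    .of_norm_bounded (hf _).summable.norm
      fun m => bound (|x| + 1) (by positivity) m x (by linarith)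
  refine ⟨fun x => ∑' m : ℕ, c m * (m * x ^ (m - 1)), fun x => ?_, fun x => ?_⟩
  · have hfun : f = fun x => ∑' m, c m * x ^ m := funext fun x => (hf x).tsum_eq.symm
    rw [hfun]
    refine hasDerivAt_tsum_of_isPreconnected (t := Ioo (-(|x| + 1)) (|x| + 1)) (y₀ := 0)
      (hf (2 * (|x| + 1 + 1))).summable.norm isOpen_Ioo isPreconnected_Ioo
      (fun m y _ => (hasDerivAt_pow m y).const_mul (c m)) (fun m y hy => ?_) ?_ (hf 0).summable ?_
    · exact bound (|x| + 1) (by positivity) m y (abs_lt.2 hy)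
    · constructor <;> linarith [abs_nonneg x]
    · exact abs_lt.1 (by linarith)
  · have h := (hasSum_nat_add_iff' (f := fun m : ℕ => c m * (m * x ^ (m - 1))) 1).2 (summ x).hasSum
    simp only [Finset.range_one, Finset.sum_singleton, Nat.cast_zero, zero_mul, mul_zero,
      sub_zero, Nat.add_sub_cancel, Nat.cast_add, Nat.cast_one] at h
    exact hasSum_of_eq (fun m => by ring) h

theorem contDiff_of_hasSum_pow (hf : ∀ x, HasSum (fun m => c m * x ^ m) (f x)) :
    ContDiff ℝ (⊤ : ℕ∞) f := by
  refine contDiff_infty.2 fun n => ?_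
  induction n generalizing c f with
  | zero =>
    obtain ⟨g, hg, -⟩ := exists_hasDerivAt_of_hasSum_pow hf
    exact contDiff_zero.2 (continuous_iff_continuousAt.2 fun x => (hg x).continuousAt)
  | succ n ih =>
    obtain ⟨g, hg, hgs⟩ := exists_hasDerivAt_of_hasSum_pow hf
    rw [Nat.cast_add, Nat.cast_one, contDiff_succ_iff_deriv]
    refine ⟨fun x => (hg x).differentiableAt, by simp, ?_⟩
    rw [funext fun x => (hg x).deriv]
    exact ih hgs

theorem absolutelyMonotoneOn_of_hasSum_pow (hc : ∀ m, 0 ≤ c m)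
    (hf : ∀ x, HasSum (fun m => c m * x ^ m) (f x)) : AbsolutelyMonotoneOn f (Ioi 0) := by
  refine .of_contDiff (contDiff_of_hasSum_pow hf) fun n => ?_
  induction n generalizing c f with
  | zero =>
    intro x hx
    rw [iteratedDeriv_zero]
    exact (hf x).nonneg fun m => mul_nonneg (hc m) (pow_nonneg (le_of_lt hx) m)
  | succ n ih =>
    obtain ⟨g, hg, hgs⟩ := exists_hasDerivAt_of_hasSum_pow hf
    rw [iteratedDeriv_succ', funext fun x => (hg x).deriv]
    exact ih (fun m => mul_nonneg (by positivity) (hc _)) hgs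

/-- The derivative of `f(1/y)` is `-G(1/y)` with `G(x) = x² f'(x)`, and `G` is again an entire
series with nonnegative coefficients, so induction applies to `G`. -/
theorem iteratedDerivWithin_comp_inv_nonneg (hc : ∀ m, 0 ≤ c m)
    (hf : ∀ x, HasSum (fun m => c m * x ^ m) (f x)) (n : ℕ) :
    ∀ y ∈ Ioi (0 : ℝ), 0 ≤ (-1) ^ n * iteratedDerivWithin n (fun y => f (1 / y)) (Ioi 0) y := by
  induction n generalizing c f with
  | zero =>
    intro y hy
    have hy' : (0 : ℝ) < y := hy
    rw [iteratedDerivWithin_zero, pow_zero, one_mul]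
    exact (hf _).nonneg fun m => mul_nonneg (hc m) (by positivity)
  | succ n ih =>
    intro y hy
    obtain ⟨g, hg, hgs⟩ := exists_hasDerivAt_of_hasSum_pow hf
    have hG (x : ℝ) : HasSum (fun m : ℕ => (((m - 1 : ℕ) : ℝ) * c (m - 1)) * x ^ m)
        (x ^ 2 * g x) := by
      -- The coefficient `(m-1) c_{m-1}` vanishes at `m = 0` (truncated subtraction) and at `m = 1`.
      rw [← hasSum_nat_add_iff' 2]
      have h0 : ∑ i ∈ Finset.range 2, ((i - 1 : ℕ) : ℝ) * c (i - 1) * x ^ i = 0 := by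
        simp [Finset.sum_range_succ]
      rw [h0, sub_zero]
      refine hasSum_of_eq (fun m => ?_) ((hgs x).mul_left (x ^ 2))
      rw [show m + 2 - 1 = m + 1 from rfl, Nat.cast_add, Nat.cast_one]
      ring
    have hd : EqOn (derivWithin (fun y => f (1 / y)) (Ioi 0))
        (-fun y => (1 / y) ^ 2 * g (1 / y)) (Ioi 0) := by
      intro z hz
      have hz' : (z : ℝ) ≠ 0 := (ne_of_gt hz)
      rw [derivWithin_of_isOpen isOpen_Ioi hz]
      have h1 : HasDerivAt (fun y : ℝ => 1 / y) (-(z ^ 2)⁻¹) z := by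
        simpa using hasDerivAt_inv hz'
      have h2 := (hg (1 / z)).comp z h1
      rw [show (fun y => f (1 / y)) = f ∘ (fun y => 1 / y) from rfl, h2.deriv]
      simp [mul_comm]
    rw [iteratedDerivWithin_succ', iteratedDerivWithin_congr hd hy, iteratedDerivWithin_neg]
    have := ih (fun m => mul_nonneg (by positivity) (hc _)) hG y hy
    rw [pow_succ]
    simpa using this

theorem completelyMonotoneOn_comp_inv (hc : ∀ m, 0 ≤ c m)
    (hf : ∀ x, HasSum (fun m => c m * x ^ m) (f x)) :
    CompletelyMonotoneOn (fun y => f (1 / y)) (Ioi 0) := by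
  refine ⟨?_, iteratedDerivWithin_comp_inv_nonneg hc hf⟩
  refine (contDiff_of_hasSum_pow hf).comp_contDiffOn ?_
  exact contDiffOn_const.div contDiffOn_id fun x hx => ne_of_gt hx

theorem hasSum_pow_pos (hc : ∀ m, 0 ≤ c m) (hf : ∀ x, HasSum (fun m => c m * x ^ m) (f x))
    {n : ℕ} (hn : 0 < c n) {x : ℝ} (hx : 0 < x) : 0 < f x :=
  (mul_pos hn (pow_pos hx n)).trans_le <|
    le_hasSum (hf x) n fun m _ => mul_nonneg (hc m) (pow_pos hx m).le

theorem hasSum_pow_monotone (hc : ∀ m, 0 ≤ c m) (hf : ∀ x, HasSum (fun m => c m * x ^ m) (f x))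
    {x y : ℝ} (hx : 0 ≤ x) (hxy : x ≤ y) : f x ≤ f y :=
  hasSum_le (fun m => mul_le_mul_of_nonneg_left (pow_le_pow_left₀ hx hxy m) (hc m)) (hf x) (hf y)

/-- This is Hölder's inequality for series: each series is normalised to sum `1`, and weighted AM-GM
is applied term by term. -/
theorem multiplicativelyConvex_of_hasSum_pow (hc : ∀ m, 0 ≤ c m) {n : ℕ} (hn : 0 < c n)
    (hf : ∀ x, HasSum (fun m => c m * x ^ m) (f x)) : MultiplicativelyConvex f := by
  have pos {x : ℝ} (hx : 0 < x) : 0 < f x := hasSum_pow_pos hc hf hn hx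
  refine ⟨fun x => pos, fun x y t hx hy ht0 ht1 => ?_⟩
  have hX := pos hx
  have hY := pos hy
  have hs := (((hf x).div_const (f x)).mul_left t).add
    (((hf y).div_const (f y)).mul_left (1 - t))
  rw [div_self hX.ne', div_self hY.ne', mul_one, mul_one, add_sub_cancel] at hs
  have hP : 0 < f x ^ t * f y ^ (1 - t) := by positivity
  rw [← div_le_one hP]
  refine hasSum_le (fun m => ?_) ((hf (x ^ t * y ^ (1 - t))).div_const (f x ^ t * f y ^ (1 - t))) hs
  have h := Real.geom_mean_le_arith_mean2_weighted ht0 (sub_nonneg.2 ht1)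
    (by positivity : 0 ≤ x ^ m / f x) (by positivity : 0 ≤ y ^ m / f y) (by ring)
  rw [Real.div_rpow (by positivity) hX.le, Real.div_rpow (by positivity) hY.le,
    ← Real.rpow_pow_comm hx.le, ← Real.rpow_pow_comm hy.le, div_mul_div_comm, ← mul_pow] at h
  calc _ = c m * ((x ^ t * y ^ (1 - t)) ^ m / (f x ^ t * f y ^ (1 - t))) := by ring
    _ ≤ c m * _ := mul_le_mul_of_nonneg_left h (hc m)
    _ = _ := by ring

/-- Since `f` is increasing on `[0, ∞)`, AM-GM replaces the arithmetic mean inside `f(1/·)` by the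
geometric one, where multiplicative convexity applies. -/
theorem logConvexOn_comp_inv (hc : ∀ m, 0 ≤ c m) {n : ℕ} (hn : 0 < c n)
    (hf : ∀ x, HasSum (fun m => c m * x ^ m) (f x)) :
    LogConvexOn (fun y => f (1 / y)) (Ioi 0) := by
  have hmc := multiplicativelyConvex_of_hasSum_pow hc hn hf
  refine ⟨fun x hx => hmc.1 _ (one_div_pos.2 hx), convex_Ioi 0, fun x hx y hy s t hs ht hst => ?_⟩
  have hx' : (0 : ℝ) < x := hx
  have hy' : (0 : ℝ) < y := hy
  obtain rfl : t = 1 - s := by linarith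
  have hxi : 0 < 1 / x := by positivity
  have hyi : 0 < 1 / y := by positivity
  have hX := hmc.1 _ hxi
  have hY := hmc.1 _ hyi
  simp only [smul_eq_mul]
  have ham := Real.geom_mean_le_arith_mean2_weighted hs ht hx'.le hy'.le hst
  have hle : f (1 / (s * x + (1 - s) * y)) ≤ f (1 / x) ^ s * f (1 / y) ^ (1 - s) := by
    refine (hasSum_pow_monotone hc hf ?_ ?_).trans
      (hmc.2 (1 / x) (1 / y) s hxi hyi hs (by linarith))
    · positivity
    · rw [Real.div_rpow zero_le_one hx'.le, Real.div_rpow zero_le_one hy'.le, Real.one_rpow,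
        Real.one_rpow, one_div_mul_one_div]
      exact one_div_le_one_div_of_le (by positivity) ham
  have hcomb : 0 < s * x + (1 - s) * y :=
    lt_of_lt_of_le (by positivity : 0 < x ^ s * y ^ (1 - s)) ham
  rw [← Real.log_rpow hX, ← Real.log_rpow hY, ← Real.log_mul (by positivity) (by positivity)]
  exact Real.log_le_log (hmc.1 _ (one_div_pos.2 hcomb)) hle

/-- The density `t ^ m / m!` on the half-line has Laplace transform `s ↦ s ^ (-(m + 1))`. -/
theorem lintegral_exp_neg_div_mul_pow {x : ℝ} (hx : 0 < x) (m : ℕ) :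
    ∫⁻ t in Ioi (0 : ℝ), ENNReal.ofReal (t ^ m / m.factorial) * ENNReal.ofReal (Real.exp (-t / x))
      = ENNReal.ofReal (x ^ (m + 1)) := by
  have hm : (0 : ℝ) < m + 1 := by positivity
  have hval := Real.integral_rpow_mul_exp_neg_mul_Ioi hm (one_div_pos.2 hx)
  have hint : IntegrableOn (fun t : ℝ => t ^ m / m.factorial * Real.exp (-t / x)) (Ioi 0) := by
    have h := (integrableOn_rpow_mul_exp_neg_mul_rpow (s := m) (p := 1) (b := 1 / x)
      (by linarith) one_pos (one_div_pos.2 hx)).div_const (m.factorial : ℝ)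
    refine IntegrableOn.congr_fun h (fun t _ => ?_) measurableSet_Ioi
    simp only [Real.rpow_natCast, Real.rpow_one]
    rw [show -(1 / x) * t = -t / x by ring]
    ring
  have hval' : ∫ t in Ioi (0 : ℝ), t ^ m / m.factorial * Real.exp (-t / x) = x ^ (m + 1) := by
    have : ∀ t ∈ Ioi (0 : ℝ), t ^ m / m.factorial * Real.exp (-t / x) =
        t ^ ((m : ℝ) + 1 - 1) * Real.exp (-(1 / x * t)) / m.factorial := by
      intro t _
      rw [add_sub_cancel_right, Real.rpow_natCast, show -(1 / x * t) = -t / x by ring]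
      ring
    rw [setIntegral_congr_fun measurableSet_Ioi this, integral_div, hval, Real.Gamma_nat_eq_factorial,
      one_div_one_div, mul_div_cancel_right₀ _ (by positivity)]
    exact_mod_cast Real.rpow_natCast x (m + 1)
  rw [← hval', ofReal_integral_eq_lintegral_ofReal hint]
  · refine setLIntegral_congr_fun measurableSet_Ioi fun t ht => ?_
    have : (0 : ℝ) < t := ht
    exact (ENNReal.ofReal_mul (by positivity)).symm
  · filter_upwards [ae_restrict_mem measurableSet_Ioi] with t ht
    have : (0 : ℝ) < t := ht
    simp only [Pi.zero_apply]
    positivity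

/-- Each `x^(m+1)` is the transform of the density `t^m / m!`, so `τ` is the sum of these densities
weighted by `c (m+1)`; with `c 0 = 0` no atom at the origin is needed. -/
theorem exists_measure_laplace_of_hasSum_pow (hc : ∀ m, 0 ≤ c m) (hc0 : c 0 = 0)
    (hf : ∀ x, HasSum (fun m => c m * x ^ m) (f x)) :
    ∃ τ : Measure ℝ, τ (Iio 0) = 0 ∧ ∀ x : ℝ, 0 < x →
      Integrable (fun t => Real.exp (-t / x)) τ ∧ f x = ∫ t, Real.exp (-t / x) ∂τ := by
  let μ (m : ℕ) : Measure ℝ := ENNReal.ofReal (c (m + 1)) •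
    (volume.restrict (Ioi 0)).withDensity fun t => ENNReal.ofReal (t ^ m / m.factorial)
  refine ⟨Measure.sum μ, ?_, fun x hx => ?_⟩
  · rw [Measure.sum_apply _ measurableSet_Iio]
    refine ENNReal.tsum_eq_zero.2 fun m => ?_
    rw [Measure.smul_apply, withDensity_apply _ measurableSet_Iio,
      Measure.restrict_restrict measurableSet_Iio,
      (disjoint_left.2 fun t ht ht' => lt_asymm (mem_Iio.1 ht) (mem_Ioi.1 ht') :
        Disjoint (Iio (0 : ℝ)) (Ioi 0)).inter_eq]
    simp
  · have hcont : Continuous fun t : ℝ => Real.exp (-t / x) := by fun_prop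
    have hfx : 0 ≤ f x := (hf x).nonneg fun m => mul_nonneg (hc m) (by positivity)
    have hsum : HasSum (fun m => c (m + 1) * x ^ (m + 1)) (f x) := by
      have := (hasSum_nat_add_iff' 1).2 (hf x)
      simpa [hc0] using this
    have hl : ∫⁻ t, ENNReal.ofReal (Real.exp (-t / x)) ∂(Measure.sum μ) = ENNReal.ofReal (f x) := by
      rw [lintegral_sum_measure, ← hsum.tsum_eq, ENNReal.ofReal_tsum_of_nonneg
        (fun m => mul_nonneg (hc _) (by positivity)) hsum.summable]
      refine tsum_congr fun m => ?_
      rw [lintegral_smul_measure, lintegral_withDensity_eq_lintegral_mul _ (by fun_prop)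
        (by fun_prop)]
      simp only [Pi.mul_apply]
      rw [lintegral_exp_neg_div_mul_pow hx, smul_eq_mul, ENNReal.ofReal_mul (hc _)]
    have hnn : 0 ≤ᵐ[Measure.sum μ] fun t : ℝ => Real.exp (-t / x) :=
      .of_forall fun t => (Real.exp_pos _).le
    refine ⟨⟨hcont.aestronglyMeasurable, ?_⟩, ?_⟩
    · rw [hasFiniteIntegral_iff_ofReal hnn, hl]
      exact ENNReal.ofReal_lt_top
    · rw [integral_eq_lintegral_of_nonneg_ae hnn hcont.aestronglyMeasurable, hl,
        ENNReal.toReal_ofReal hfx]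

/-- Cauchy product of everywhere convergent power series. -/
theorem hasSum_pow_mul {b c : ℕ → ℝ} {x A B : ℝ} (hb : HasSum (fun m => b m * x ^ m) A)
    (hc : HasSum (fun m => c m * x ^ m) B) :
    HasSum (fun m => (∑ p ∈ Finset.HasAntidiagonal.antidiagonal m, b p.1 * c p.2) * x ^ m) (A * B) := by
  have hb' := hb.summable.norm
  have hc' := hc.summable.norm
  have h := (summable_norm_sum_mul_antidiagonal_of_summable_norm hb' hc').of_norm.hasSum
  rw [← tsum_mul_tsum_eq_tsum_sum_antidiagonal_of_summable_norm hb' hc', hb.tsum_eq,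
    hc.tsum_eq] at h
  refine hasSum_of_eq (fun m => ?_) h
  rw [Finset.sum_mul]
  refine Finset.sum_congr rfl fun p hp => ?_
  rw [← Finset.HasAntidiagonal.mem_antidiagonal.1 hp, pow_add]
  ring

end EntireSeries

/-! ### Digamma: recursion, monotonicity, concavity -/

section Digamma

open Filter Topology

theorem differentiableAt_Gamma_of_pos {x : ℝ} (hx : 0 < x) : DifferentiableAt ℝ Real.Gamma x :=
  Real.differentiableAt_Gamma fun m => by
    have : (0 : ℝ) ≤ m := m.cast_nonneg
    linarith

theorem digamma_add_one {x : ℝ} (hx : 0 < x) : digamma (x + 1) = digamma x + 1 / x := by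
  have hG := Real.Gamma_pos_of_pos hx
  have h1 : HasDerivAt (fun y => Real.Gamma (y + 1)) (deriv Real.Gamma (x + 1)) x :=
    (differentiableAt_Gamma_of_pos (by linarith : 0 < x + 1)).hasDerivAt.comp_add_const x 1
  have h2 : HasDerivAt (fun y => y * Real.Gamma y) (1 * Real.Gamma x + x * deriv Real.Gamma x) x :=
    (hasDerivAt_id x).mul (differentiableAt_Gamma_of_pos hx).hasDerivAt
  have h3 : (fun y => Real.Gamma (y + 1)) =ᶠ[𝓝 x] fun y => y * Real.Gamma y := by
    filter_upwards [lt_mem_nhds hx] with y hy using Real.Gamma_add_one hy.ne'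
  rw [digamma, digamma, logDeriv_apply, logDeriv_apply,
    h1.unique (h2.congr_of_eventuallyEq h3), Real.Gamma_add_one hx.ne']
  field_simp
  ring

theorem digamma_add_natCast {x : ℝ} (hx : 0 < x) (n : ℕ) :
    digamma (x + n) = digamma x + ∑ i ∈ Finset.range n, 1 / (x + i) := by
  induction n with
  | zero => simp
  | succ n ih =>
    rw [Nat.cast_add, Nat.cast_one, ← add_assoc, digamma_add_one (by positivity), ih,
      Finset.sum_range_succ, add_assoc]

theorem monotoneOn_digamma : MonotoneOn digamma (Ioi 0) := by
  have h := Real.convexOn_log_Gamma.monotoneOn_deriv fun x hx =>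
    ((differentiableAt_Gamma_of_pos hx).log (Real.Gamma_pos_of_pos hx).ne')
  refine h.congr fun x hx => ?_
  rw [digamma, logDeriv_apply]
  exact deriv.log (differentiableAt_Gamma_of_pos hx) (Real.Gamma_pos_of_pos hx).ne'

/-- Monotonicity squeezes the difference between `0` and an increment over `N` unit steps, with `N ≥
y - x`; the recursion writes this increment as `N` terms tending to `0`. -/
theorem tendsto_digamma_add_natCast_sub {x y : ℝ} (hx : 0 < x) (hxy : x ≤ y) :
    Tendsto (fun n : ℕ => digamma (y + n) - digamma (x + n)) atTop (𝓝 0) := by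
  obtain ⟨N, hN⟩ := exists_nat_ge (y - x)
  have hlim : Tendsto (fun n : ℕ => ∑ i ∈ Finset.range N, 1 / (x + n + i)) atTop (𝓝 0) := by
    rw [← Finset.sum_const_zero (s := Finset.range N)]
    refine tendsto_finsetSum _ fun i _ => ?_
    refine tendsto_const_nhds.div_atTop ?_
    exact tendsto_atTop_add_const_right _ _
      (tendsto_atTop_add_const_left _ _ tendsto_natCast_atTop_atTop)
  refine squeeze_zero (fun n => ?_) (fun n => ?_) hlim
  · exact sub_nonneg.2 (monotoneOn_digamma (mem_Ioi.2 (by positivity))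
      (mem_Ioi.2 (by have : (0 : ℝ) ≤ n := n.cast_nonneg; linarith)) (by linarith))
  · have hxn : 0 < x + n := by positivity
    have h1 : digamma (y + n) ≤ digamma (x + n + N) :=
      monotoneOn_digamma (mem_Ioi.2 (by linarith)) (mem_Ioi.2 (by positivity)) (by linarith)
    rw [digamma_add_natCast hxn] at h1
    linarith

theorem tendsto_sum_digamma_sub {a y : ℝ} (ha : 0 < a) (hy : 0 ≤ y) :
    Tendsto (fun n : ℕ => ∑ i ∈ Finset.range n, (1 / (a + i) - 1 / (a + y + i))) atTop
      (𝓝 (digamma (a + y) - digamma a)) := by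
  have h := (tendsto_const_nhds (x := digamma (a + y) - digamma a)).sub
    (tendsto_digamma_add_natCast_sub ha (by linarith : a ≤ a + y))
  rw [sub_zero] at h
  refine h.congr fun n => ?_
  rw [digamma_add_natCast ha, digamma_add_natCast (by linarith : 0 < a + y),
    Finset.sum_sub_distrib]
  ring

/-- The function is a pointwise limit of the sums of `1/(a+i) - 1/(a+y+i)`, each concave in `y` by
convexity of the reciprocal. -/
theorem concaveOn_digamma_sub {a : ℝ} (ha : 0 < a) :
    ConcaveOn ℝ (Ici 0) fun y : ℝ => digamma (a + y) - digamma a := by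
  refine ⟨convex_Ici 0, fun x hx y hy s t hs ht hst => ?_⟩
  have hx' : (0 : ℝ) ≤ x := hx
  have hy' : (0 : ℝ) ≤ y := hy
  simp only [smul_eq_mul]
  have hxy : 0 ≤ s * x + t * y := by positivity
  refine le_of_tendsto_of_tendsto' (((tendsto_sum_digamma_sub ha hx).const_mul s).add
    ((tendsto_sum_digamma_sub ha hy).const_mul t)) (tendsto_sum_digamma_sub ha hxy) fun n => ?_
  rw [Finset.mul_sum, Finset.mul_sum, ← Finset.sum_add_distrib]
  refine Finset.sum_le_sum fun i _ => ?_
  have hc := (convexOn_zpow (-1)).2 (mem_Ioi.2 (by positivity : 0 < a + x + i))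
    (mem_Ioi.2 (by positivity : 0 < a + y + i)) hs ht hst
  simp only [smul_eq_mul, zpow_neg, zpow_one] at hc
  rw [show s * (a + x + i) + t * (a + y + i) = a + (s * x + t * y) + i by
    linear_combination (a + i) * hst] at hc
  simp only [one_div]
  linear_combination hc + (a + (i : ℝ))⁻¹ * hst

end Digamma

/-! ### Termwise differentiation in `a`, and the sequence `h_k` -/

section ParamDeriv

open Filter

theorem digamma_sub_eq_sum {a : ℝ} (ha : 0 < a) (k : ℕ) :
    digamma (a + k) - digamma a = ∑ i ∈ Finset.range k, 1 / (a + i) := by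
  rw [digamma_add_natCast ha, add_sub_cancel_left]

theorem ascPochhammer_eval_pos {a : ℝ} (ha : 0 < a) (k : ℕ) : 0 < (ascPochhammer ℝ k).eval a :=
  ascPochhammer_pos k a ha

theorem hasDerivAt_ascPochhammer_eval {a : ℝ} (ha : 0 < a) (k : ℕ) :
    HasDerivAt (fun α => (ascPochhammer ℝ k).eval α)
      ((∑ i ∈ Finset.range k, 1 / (a + i)) * (ascPochhammer ℝ k).eval a) a := by
  induction k with
  | zero => simpa using hasDerivAt_const a (1 : ℝ)
  | succ k ih =>
    simp only [ascPochhammer_succ_eval]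
    have hk : a + k ≠ 0 := by positivity
    refine (ih.mul ((hasDerivAt_id a).add_const (k : ℝ))).congr_deriv ?_
    rw [Finset.sum_range_succ]
    simp only [id]
    field_simp

theorem ascPochhammer_eval_div_factorial_le {α A : ℝ} (hα : 0 ≤ α) (hA : α ≤ A) (k : ℕ) :
    (ascPochhammer ℝ k).eval α / k.factorial ≤ (A + 1) ^ k := by
  induction k with
  | zero => simp
  | succ k ih =>
    have hk : (0 : ℝ) ≤ k := k.cast_nonneg
    rw [ascPochhammer_succ_eval, Nat.factorial_succ, Nat.cast_mul, mul_comm ((k + 1 : ℕ) : ℝ),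
      mul_div_mul_comm, pow_succ]
    refine mul_le_mul ih ?_ (by positivity) (pow_nonneg (by linarith) k)
    rw [Nat.cast_add, Nat.cast_one, div_le_iff₀ (by positivity)]
    nlinarith

theorem summable_pow_div_Gamma (ν r : ℝ) : Summable fun k : ℕ => r ^ k / Real.Gamma (ν + k) := by
  refine summable_of_ratio_norm_eventually_le (r := 1 / 2) (by norm_num) ?_
  -- From `N` on, `ν + k` is positive, hence past the poles, and at least `2|r|`, so the term ratio
  -- is at most `1/2`.
  obtain ⟨N, hN⟩ := exists_nat_ge (2 * |r| + 1 - ν)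
  filter_upwards [eventually_ge_atTop N] with k hk
  have hk' : (N : ℝ) ≤ k := Nat.cast_le.2 hk
  have hpos : 2 * |r| + 1 ≤ ν + k := by linarith
  have h0 : 0 < ν + k := by linarith [abs_nonneg r]
  have hG := Real.Gamma_pos_of_pos h0
  rw [Nat.cast_add, Nat.cast_one, ← add_assoc, Real.Gamma_add_one h0.ne', pow_succ, mul_comm (r ^ k),
    mul_div_mul_comm, norm_mul]
  refine mul_le_mul_of_nonneg_right ?_ (norm_nonneg _)
  rw [norm_div, Real.norm_eq_abs, Real.norm_eq_abs, abs_of_pos h0, div_le_iff₀ h0]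
  linarith

theorem hasDerivAt_regKummer {a : ℝ} (ha : 1 ≤ a) (ν x : ℝ) :
    Summable (fun k : ℕ => coeff a k / Real.Gamma (ν + k) * x ^ k) ∧
      HasDerivAt (fun α => regKummer α ν x)
        (∑' k : ℕ, coeff a k / Real.Gamma (ν + k) * x ^ k) a := by
  have ha0 : 0 < a := by linarith
  let T (k : ℕ) (α : ℝ) : ℝ :=
    (∑ i ∈ Finset.range k, 1 / (α + i)) * (ascPochhammer ℝ k).eval α /
      (k.factorial * Real.Gamma (ν + k)) * x ^ k
  -- Majorant uniform for `α` in `(1/2, a+1)`: each `1/(α+i)` is at most `2` and `k ≤ 2^k`, so the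
  -- harmonic factor costs `2 * 2^k`; the Pochhammer quotient costs `(a+2)^k`.
  let u (k : ℕ) : ℝ := 2 * ‖(2 * (a + 1 + 1) * x) ^ k / Real.Gamma (ν + k)‖
  have hu : Summable u := (summable_pow_div_Gamma ν _).norm.mul_left 2
  have hpoch (α : ℝ) (h0 : 0 < α) (h1 : α ≤ a + 1) (k : ℕ) :
      ‖(ascPochhammer ℝ k).eval α / k.factorial‖ ≤ (a + 1 + 1) ^ k := by
    rw [Real.norm_eq_abs, abs_of_nonneg (div_nonneg (ascPochhammer_eval_pos h0 k).le (by positivity))]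
    exact ascPochhammer_eval_div_factorial_le h0.le h1 k
  have hT (k : ℕ) (α : ℝ) (hα : α ∈ Ioo (1 / 2) (a + 1)) : ‖T k α‖ ≤ u k := by
    have hα0 : 0 < α := by linarith [hα.1]
    have hsum : ‖∑ i ∈ Finset.range k, 1 / (α + i)‖ ≤ 2 * 2 ^ k := by
      refine (norm_sum_le_of_le (f := fun i : ℕ => 1 / (α + i)) (Finset.range k)
        (n := fun _ => 2) fun i _ => ?_).trans ?_
      · rw [Real.norm_eq_abs, abs_of_pos (by positivity), div_le_iff₀ (by positivity)]
        have : (0 : ℝ) ≤ i := i.cast_nonneg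
        linarith [hα.1]
      · rw [Finset.sum_const, Finset.card_range, nsmul_eq_mul, mul_comm]
        have : (k : ℝ) ≤ 2 ^ k := by exact_mod_cast Nat.lt_two_pow_self.le
        linarith
    have e1 : T k α = (∑ i ∈ Finset.range k, 1 / (α + i)) *
        ((ascPochhammer ℝ k).eval α / k.factorial) * (x ^ k / Real.Gamma (ν + k)) := by
      simp only [T]
      ring
    have e2 : u k = 2 * 2 ^ k * (a + 1 + 1) ^ k * ‖x ^ k / Real.Gamma (ν + k)‖ := by
      simp only [u]
      rw [mul_pow, mul_pow, mul_div_assoc, norm_mul, Real.norm_eq_abs (2 ^ k * (a + 1 + 1) ^ k),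
        abs_of_pos (by positivity)]
      ring
    rw [e1, e2, norm_mul, norm_mul]
    refine mul_le_mul_of_nonneg_right ?_ (norm_nonneg _)
    exact mul_le_mul hsum (hpoch α hα0 hα.2.le k) (norm_nonneg _) (by positivity)
  have hmem : a ∈ Ioo (1 / 2) (a + 1) := ⟨by linarith, by linarith⟩
  have hTa (k : ℕ) : T k a = coeff a k / Real.Gamma (ν + k) * x ^ k := by
    simp only [T, coeff]
    rw [digamma_sub_eq_sum ha0, div_div]
  have hsummable : Summable fun k : ℕ =>
      (ascPochhammer ℝ k).eval a / (k.factorial * Real.Gamma (ν + k)) * x ^ k := by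
    refine .of_norm_bounded (summable_pow_div_Gamma ν ((a + 1 + 1) * x)).norm fun k => ?_
    rw [mul_pow, mul_div_assoc, norm_mul ((a + 1 + 1) ^ k), ← div_div, div_mul_eq_mul_div,
      mul_div_assoc, norm_mul]
    refine mul_le_mul_of_nonneg_right ((hpoch a ha0 (by linarith) k).trans (le_abs_self _))
      (norm_nonneg _)
  have key := hasDerivAt_tsum_of_isPreconnected hu isOpen_Ioo isPreconnected_Ioo
    (g := fun (k : ℕ) α => (ascPochhammer ℝ k).eval α / (k.factorial * Real.Gamma (ν + k)) * x ^ k)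
    (fun k α hα => ((hasDerivAt_ascPochhammer_eval (by linarith [hα.1] : 0 < α) k).div_const
      (k.factorial * Real.Gamma (ν + k))).mul_const (x ^ k)) hT hmem hsummable hmem
  have hfun : (fun k => T k a) = fun k : ℕ => coeff a k / Real.Gamma (ν + k) * x ^ k := funext hTa
  exact ⟨hfun ▸ Summable.of_norm_bounded hu fun k => hT k a hmem,
    key.congr_deriv (congrArg tsum hfun)⟩

theorem hasSum_paramDeriv {a : ℝ} (ha : 1 ≤ a) (ν x : ℝ) :
    HasSum (fun k : ℕ => coeff a k / Real.Gamma (ν + k) * x ^ k) (paramDeriv a ν x) := by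
  obtain ⟨hs, hd⟩ := hasDerivAt_regKummer ha ν x
  rw [paramDeriv, hd.deriv]
  exact hs.hasSum

theorem coeff_zero (a : ℝ) : coeff a 0 = 0 := by
  simp [coeff]

theorem coeff_succ_pos {a : ℝ} (ha : 0 < a) (k : ℕ) : 0 < coeff a (k + 1) := by
  rw [coeff, digamma_sub_eq_sum ha]
  have h1 : 0 < ∑ i ∈ Finset.range (k + 1), 1 / (a + i) :=
    Finset.sum_pos (fun i _ => by positivity) (by simp)
  have h2 := ascPochhammer_eval_pos ha (k + 1)
  positivity

/-- The sequence is a product of two log-concave ones: partial sums of the decreasing sequence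
`1/(a+i)` (strictly so), and `(a)_k / k!`, whose ratios `(a+k)/(k+1)` are nonincreasing because `a ≥
1`. -/
theorem coeff_mul_coeff_lt {a : ℝ} (ha : 1 ≤ a) (k : ℕ) :
    coeff a k * coeff a (k + 2) < coeff a (k + 1) ^ 2 := by
  have ha0 : 0 < a := by linarith
  have hk : (0 : ℝ) ≤ k := k.cast_nonneg
  simp only [coeff]
  rw [digamma_sub_eq_sum ha0, digamma_sub_eq_sum ha0, digamma_sub_eq_sum ha0,
    Finset.sum_range_succ _ (k + 1), Finset.sum_range_succ _ k, ascPochhammer_succ_eval (k + 1),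
    ascPochhammer_succ_eval k, Nat.factorial_succ (k + 1), Nat.factorial_succ k]
  have hs : 0 ≤ ∑ i ∈ Finset.range k, 1 / (a + i) := Finset.sum_nonneg fun i _ => by positivity
  have hp := ascPochhammer_eval_pos ha0 k
  set s := ∑ i ∈ Finset.range k, 1 / (a + i)
  set p := (ascPochhammer ℝ k).eval a
  have hf : (0 : ℝ) < k.factorial := by positivity
  push_cast
  set F : ℝ := (k.factorial : ℝ)
  set d := 1 / (a + k) with hd
  set e := 1 / (a + (k + 1)) with he
  have hd0 : 0 < d := by positivity
  have he0 : 0 < e := by positivity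
  have hed : e ≤ d := one_div_le_one_div_of_le (by positivity) (by linarith)
  have hlog : s * (s + d + e) < (s + d) ^ 2 := by nlinarith [mul_nonneg hs (sub_nonneg.2 hed)]
  have hratio : (a + (k + 1)) / (k + 1 + 1) ≤ (a + k) / (k + 1) := by
    rw [div_le_div_iff₀ (by positivity) (by positivity)]
    nlinarith
  have hq : 0 < (p / F) ^ 2 * ((a + k) / (k + 1)) := by positivity
  calc _ = s * (s + d + e) * ((p / F) ^ 2 * ((a + k) / (k + 1))) *
        ((a + (k + 1)) / (k + 1 + 1)) := by field_simp
    _ ≤ s * (s + d + e) * ((p / F) ^ 2 * ((a + k) / (k + 1))) * ((a + k) / (k + 1)) := by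
        refine mul_le_mul_of_nonneg_left hratio ?_
        positivity
    _ < (s + d) ^ 2 * ((p / F) ^ 2 * ((a + k) / (k + 1))) * ((a + k) / (k + 1)) := by
        refine mul_lt_mul_of_pos_right (mul_lt_mul_of_pos_right hlog hq) (by positivity)
    _ = _ := by field_simp

end ParamDeriv

/-! ### Symmetrisation of Cauchy products, and ratios of Gamma weights -/

section Coefficients

/-- For a strictly log-concave sequence vanishing at most at `0`, products spread out decrease. -/
theorem mul_succ_lt_succ_mul {h : ℕ → ℝ} (hpos : ∀ k, 0 < h (k + 1))
    (hlog : ∀ k, h k * h (k + 2) < h (k + 1) ^ 2) {i j : ℕ} (hij : i < j) :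
    h i * h (j + 1) < h (i + 1) * h j := by
  -- With the ratio in this orientation the denominators stay positive even when `h 0 = 0`.
  have hmono : StrictMono fun k => h k / h (k + 1) := strictMono_nat_of_lt_succ fun k => by
    rw [div_lt_div_iff₀ (hpos k) (hpos (k + 1)), ← sq]
    exact hlog k
  have := hmono hij
  rw [div_lt_div_iff₀ (hpos i) (hpos j)] at this
  rwa [mul_comm (h (i + 1))]

open Finset.HasAntidiagonal in
/-- Coefficients of `F₁ G₀ - F₀ G₁`, where `F₀, G₀` have coefficients `h k * u k`, `h k * v k` and
`F₁, G₁` have the shifted ones `h k * u (k + 1)`, `h k * v (k + 1)`. -/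
theorem sum_antidiagonal_shift_sub_pos {h u v : ℕ → ℝ} (h0 : h 0 = 0) (hpos : ∀ k, 0 < h (k + 1))
    (hlog : ∀ k, h k * h (k + 2) < h (k + 1) ^ 2)
    (huv : ∀ p q, 1 ≤ p → p < q → u p * v q < u q * v p) {m : ℕ} (hm : 2 ≤ m) :
    0 < ∑ p ∈ antidiagonal m, (h p.1 * u (p.1 + 1)) * (h p.2 * v p.2)
      - ∑ p ∈ antidiagonal m, (h p.1 * u p.1) * (h p.2 * v (p.2 + 1)) := by
  let D (p : ℕ × ℕ) : ℝ := h (p.1 - 1) * h p.2 - h p.1 * h (p.2 - 1)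
  -- Moving the shift from the weights to `h` adds a boundary term, which vanishes because `h 0 =
  -- 0`; truncated `0 - 1` gives `h 0` there.
  have e1 : ∑ p ∈ antidiagonal m, (h p.1 * u (p.1 + 1)) * (h p.2 * v p.2) =
      ∑ p ∈ antidiagonal (m + 1), h (p.1 - 1) * h p.2 * (u p.1 * v p.2) := by
    rw [Finset.Nat.sum_antidiagonal_succ]
    simp only [zero_tsub, h0, zero_mul, zero_add, Nat.add_sub_cancel]
    exact Finset.sum_congr rfl fun p _ => by ring
  have e2 : ∑ p ∈ antidiagonal m, (h p.1 * u p.1) * (h p.2 * v (p.2 + 1)) =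
      ∑ p ∈ antidiagonal (m + 1), h p.1 * h (p.2 - 1) * (u p.1 * v p.2) := by
    rw [Finset.Nat.sum_antidiagonal_succ']
    simp only [zero_tsub, h0, mul_zero, zero_mul, zero_add, Nat.add_sub_cancel]
    exact Finset.sum_congr rfl fun p _ => by ring
  have e3 : ∑ p ∈ antidiagonal m, (h p.1 * u (p.1 + 1)) * (h p.2 * v p.2)
      - ∑ p ∈ antidiagonal m, (h p.1 * u p.1) * (h p.2 * v (p.2 + 1)) =
      ∑ p ∈ antidiagonal (m + 1), D p * (u p.1 * v p.2) := by
    rw [e1, e2, ← Finset.sum_sub_distrib]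
    exact Finset.sum_congr rfl fun p _ => by simp only [D]; ring
  have e4 : ∑ p ∈ antidiagonal (m + 1), D p * (u p.1 * v p.2) =
      ∑ p ∈ antidiagonal (m + 1), -D p * (u p.2 * v p.1) := by
    rw [← Finset.Nat.sum_antidiagonal_swap]
    exact Finset.sum_congr rfl fun p _ => by simp only [D, Prod.fst_swap, Prod.snd_swap]; ring
  have hD (p q : ℕ) (hp : 1 ≤ p) (hpq : p < q) : D (p, q) < 0 := by
    obtain ⟨p, rfl⟩ := Nat.exists_eq_add_of_le' hp
    obtain ⟨q, rfl⟩ := Nat.exists_eq_add_of_le' (hp.trans hpq.le)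
    exact sub_neg.2 (mul_succ_lt_succ_mul hpos hlog (by omega : p < q))
  have hterm (p q : ℕ) (hp : 1 ≤ p) (hpq : p < q) :
      0 < D (p, q) * (u p * v q - u q * v p) :=
    mul_pos_of_neg_of_neg (hD p q hp hpq) (sub_neg.2 (huv p q hp hpq))
  have hswap (p q : ℕ) : D (p, q) * (u p * v q - u q * v p) =
      D (q, p) * (u q * v p - u p * v q) := by
    simp only [D]
    ring
  have hnn (p q : ℕ) : 0 ≤ D (p, q) * (u p * v q - u q * v p) := by
    rcases Nat.eq_zero_or_pos p with rfl | hp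
    · simp [D, h0]
    rcases Nat.eq_zero_or_pos q with rfl | hq
    · simp [D, h0]
    rcases lt_trichotomy p q with hpq | rfl | hpq
    · exact (hterm p q hp hpq).le
    · simp
    · rw [hswap]
      exact (hterm q p hq hpq).le
  have hsum : 0 < ∑ p ∈ antidiagonal (m + 1), D p * (u p.1 * v p.2 - u p.2 * v p.1) :=
    Finset.sum_pos' (fun p _ => hnn p.1 p.2)
      -- A strictly positive term; `m ≥ 2` is what makes `1 < m`.
      ⟨(1, m), mem_antidiagonal.2 (add_comm 1 m), hterm 1 m le_rfl (by omega)⟩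
  have e5 : ∑ p ∈ antidiagonal (m + 1), D p * (u p.1 * v p.2 - u p.2 * v p.1) =
      ∑ p ∈ antidiagonal (m + 1), D p * (u p.1 * v p.2) +
        ∑ p ∈ antidiagonal (m + 1), -D p * (u p.2 * v p.1) := by
    rw [← Finset.sum_add_distrib]
    exact Finset.sum_congr rfl fun p _ => by ring
  rw [e5, ← e4] at hsum
  rw [e3]
  linarith

/-- The value `0` for `1/Γ` at the poles makes the recursion valid at every real argument. -/
theorem inv_Gamma_eq_mul (u : ℝ) : (Real.Gamma u)⁻¹ = u * (Real.Gamma (u + 1))⁻¹ := by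
  rcases eq_or_ne u 0 with rfl | hu
  · simp
  · rw [Real.Gamma_add_one hu, mul_inv, mul_inv_cancel_left₀ hu]

theorem inv_Gamma_nonneg {u : ℝ} (hu : 0 ≤ u) : 0 ≤ (Real.Gamma u)⁻¹ :=
  inv_nonneg.2 (Real.Gamma_nonneg_of_nonneg hu)

theorem inv_Gamma_pos {u : ℝ} (hu : 0 < u) : 0 < (Real.Gamma u)⁻¹ :=
  inv_pos.2 (Real.Gamma_pos_of_pos hu)

/-- By the recursion, the ratio of the two weights at `k` is `(ν+k)/(ν+β+k) < 1` times the ratio at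
`k + 1`, hence strictly increasing for `k ≥ 1`. At `ν = -1` the first ratio is merely `0`. -/
theorem inv_Gamma_mul_inv_Gamma_lt {ν β : ℝ} (hν : -1 ≤ ν) (hβ : 0 < β) {p q : ℕ} (hp : 1 ≤ p)
    (hpq : p < q) : (Real.Gamma (ν + p))⁻¹ * (Real.Gamma (ν + β + q))⁻¹ <
      (Real.Gamma (ν + q))⁻¹ * (Real.Gamma (ν + β + p))⁻¹ := by
  have hnn (k : ℕ) : (0 : ℝ) ≤ k := k.cast_nonneg
  have hpos (k : ℕ) : 0 < (Real.Gamma (ν + β + (k + 1 : ℕ)))⁻¹ :=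
    inv_Gamma_pos (by push_cast; linarith [hnn k])
  have hmono : StrictMono fun k : ℕ =>
      (Real.Gamma (ν + (k + 1 : ℕ)))⁻¹ / (Real.Gamma (ν + β + (k + 1 : ℕ)))⁻¹ := by
    refine strictMono_nat_of_lt_succ fun k => ?_
    have h1 := inv_Gamma_eq_mul (ν + (k + 1 : ℕ))
    have h2 := inv_Gamma_eq_mul (ν + β + (k + 1 : ℕ))
    rw [add_assoc ν, ← Nat.cast_succ, Nat.succ_eq_add_one] at h1
    rw [add_assoc (ν + β), ← Nat.cast_succ, Nat.succ_eq_add_one] at h2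
    have h3 : 0 < (Real.Gamma (ν + (k + 1 + 1 : ℕ)))⁻¹ :=
      inv_Gamma_pos (by push_cast; linarith [hnn k])
    rw [div_lt_div_iff₀ (hpos k) (hpos (k + 1)), h1, h2]
    have := mul_pos h3 (hpos (k + 1))
    nlinarith
  obtain ⟨p, rfl⟩ := Nat.exists_eq_add_of_le' hp
  obtain ⟨q, rfl⟩ := Nat.exists_eq_add_of_le' (hp.trans hpq.le)
  have := hmono (by omega : p < q)
  rwa [div_lt_div_iff₀ (hpos p) (hpos q)] at this

/-! ### Positivity and inequalities for `h` and `λ` -/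

theorem hasSum_paramDeriv_inv {a : ℝ} (ha : 1 ≤ a) (ν x : ℝ) :
    HasSum (fun k : ℕ => coeff a k * (Real.Gamma (ν + k))⁻¹ * x ^ k) (paramDeriv a ν x) :=
  hasSum_paramDeriv ha ν x

theorem hasSum_paramDeriv_add_one {a : ℝ} (ha : 1 ≤ a) (ν x : ℝ) :
    HasSum (fun k : ℕ => coeff a k * (Real.Gamma (ν + (k + 1 : ℕ)))⁻¹ * x ^ k)
      (paramDeriv a (ν + 1) x) :=
  hasSum_of_eq (fun k => by rw [Nat.cast_succ, add_assoc, add_comm (1 : ℝ)])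
    (hasSum_paramDeriv_inv ha (ν + 1) x)

theorem paramDeriv_pos {a : ℝ} (ha : 1 ≤ a) {ν x : ℝ} (hν : -1 ≤ ν) (hx : 0 < x) :
    0 < paramDeriv a ν x := by
  have ha0 : 0 < a := by linarith
  -- At `ν = -1` the term `k = 1` vanishes too, so `k = 2` is the first one positive for every
  -- admissible `ν`.
  refine hasSum_pow_pos (n := 2) (fun m => ?_) (hasSum_paramDeriv_inv ha ν) ?_ hx
  · rcases m with _ | m
    · simp [coeff_zero]
    · refine mul_nonneg (coeff_succ_pos ha0 m).le (inv_Gamma_nonneg ?_)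
      push_cast
      linarith [(m.cast_nonneg : (0 : ℝ) ≤ m)]
  · exact mul_pos (coeff_succ_pos ha0 1) (inv_Gamma_pos (by push_cast; linarith))

theorem exists_hasSum_lam {a β ν : ℝ} (ha : 1 ≤ a) (hν : -1 ≤ ν) (hβ : 0 < β) :
    ∃ c : ℕ → ℝ, c 0 = 0 ∧ c 1 = 0 ∧ (∀ m : ℕ, 2 ≤ m → 0 < c m) ∧
      ∀ x : ℝ, HasSum (fun m : ℕ => c m * x ^ m) (lam a β ν x) := by
  have ha0 : 0 < a := by linarith
  refine ⟨_, ?_, ?_, fun m hm => sum_antidiagonal_shift_sub_pos (coeff_zero a)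
    (coeff_succ_pos ha0) (coeff_mul_coeff_lt ha) (u := fun k => (Real.Gamma (ν + k))⁻¹)
    (v := fun k => (Real.Gamma (ν + β + k))⁻¹)
    (fun p q hp hpq => inv_Gamma_mul_inv_Gamma_lt hν hβ hp hpq) hm, fun x => ?_⟩
  · simp [coeff_zero]
  · simp [Finset.Nat.sum_antidiagonal_succ, coeff_zero]
  · refine hasSum_of_eq (fun m => ?_) ((hasSum_pow_mul (hasSum_paramDeriv_add_one ha ν x)
      (hasSum_paramDeriv_inv ha (ν + β) x)).sub (hasSum_pow_mul (hasSum_paramDeriv_inv ha ν x)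
      (hasSum_paramDeriv_add_one ha (ν + β) x)))
    rw [← sub_mul]

theorem lam_pos {a β ν x : ℝ} (ha : 1 ≤ a) (hν : -1 ≤ ν) (hβ : 0 < β) (hx : 0 < x) :
    0 < lam a β ν x := by
  obtain ⟨c, h0, h1, h2, hs⟩ := exists_hasSum_lam ha hν hβ
  refine hasSum_pow_pos (fun m => ?_) hs (h2 2 le_rfl) hx
  match m with
  | 0 => exact h0.ge
  | 1 => exact h1.ge
  | m + 2 => exact (h2 _ (by omega)).le

theorem strictDiscreteWrightLogConcaveOn_paramDeriv {a x : ℝ} (ha : 1 ≤ a) (hx : 0 < x) :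
    StrictDiscreteWrightLogConcaveOn (fun ν => paramDeriv a ν x) (Ioi 0) := by
  have pos {ν : ℝ} (hν : 0 < ν) : 0 < paramDeriv a ν x := paramDeriv_pos ha (by linarith) hx
  refine ⟨fun ν hν => pos hν, fun n r μ hn hr hμ _ _ _ => ?_⟩
  have hμ' : 0 < μ := hμ
  have step {ν : ℝ} (hν : 0 < ν) : paramDeriv a ν x * paramDeriv a (ν + r + 1) x <
      paramDeriv a (ν + 1) x * paramDeriv a (ν + r) x :=
    sub_pos.1 (lam_pos ha (by linarith) hr hx)
  -- Positivity of `λ` with `β = r` is the case of a unit shift; chaining the ratios gives any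
  -- integer shift `n`.
  have hmono : StrictMono fun k : ℕ => paramDeriv a (μ + k) x / paramDeriv a (μ + k + r) x := by
    refine strictMono_nat_of_lt_succ fun k => ?_
    have h := step (by positivity : 0 < μ + k)
    rw [Nat.cast_succ, ← add_assoc, div_lt_div_iff₀ (pos (by positivity)) (pos (by positivity)),
      show μ + k + 1 + r = μ + k + r + 1 by ring]
    exact h
  have h := hmono (Nat.lt_of_succ_le hn)
  simp only [Nat.cast_zero, add_zero] at h
  rwa [div_lt_div_iff₀ (pos (by positivity)) (pos (by positivity))] at h

open Finset.HasAntidiagonal in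
theorem mul_paramDeriv_mul_paramDeriv_lt {a β ν x : ℝ} (ha : 1 ≤ a) (hν : 0 < ν) (hβ : 0 < β)
    (hx : 0 < x) : ν * (paramDeriv a (ν + 1) x * paramDeriv a (ν + β) x) <
      (ν + β) * (paramDeriv a ν x * paramDeriv a (ν + β + 1) x) := by
  have ha0 : 0 < a := by linarith
  have hh (k : ℕ) : 0 ≤ coeff a k := by
    rcases k with _ | k
    · exact (coeff_zero a).ge
    · exact (coeff_succ_pos ha0 k).le
  -- The weights are those of the raised parameters, all positive; the unraised ones are recovered
  -- as `(ν+k) u k` and `(ν+β+k) v k`.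
  let u (k : ℕ) : ℝ := (Real.Gamma (ν + (k + 1 : ℕ)))⁻¹
  let v (k : ℕ) : ℝ := (Real.Gamma (ν + β + (k + 1 : ℕ)))⁻¹
  have hu (k : ℕ) : 0 < u k := inv_Gamma_pos (by positivity)
  have hv (k : ℕ) : 0 < v k := inv_Gamma_pos (by positivity)
  have hu' (k : ℕ) : (Real.Gamma (ν + k))⁻¹ = (ν + k) * u k := by
    rw [inv_Gamma_eq_mul, add_assoc, ← Nat.cast_succ]
  have hv' (k : ℕ) : (Real.Gamma (ν + β + k))⁻¹ = (ν + β + k) * v k := by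
    rw [inv_Gamma_eq_mul, add_assoc (ν + β), ← Nat.cast_succ]
  -- The factor is `(ν+β)(ν+i) - ν(ν+β+j)`, with the quadratic part cancelled. Adding its mirror
  -- image leaves `β(i+j)`.
  let K (i j : ℕ) : ℝ := ((ν + β) * i - ν * j) * (u i * v j)
  have hK1 {i j : ℕ} (hij : i ≤ j) : β * (i + j) * (u i * v j) ≤ K i j + K j i := by
    have hle : u i * v j ≤ u j * v i := by
      rcases hij.eq_or_lt with rfl | hij
      · rfl
      · exact (inv_Gamma_mul_inv_Gamma_lt (by linarith) hβ (by omega : 1 ≤ i + 1)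
          (by omega : i + 1 < j + 1)).le
    -- Only the factor on the larger product `u j * v i` must be nonnegative; replacing that product
    -- by the smaller one then bounds the sum below.
    have hji : 0 ≤ (ν + β) * j - ν * i := by
      have : (i : ℝ) ≤ j := Nat.cast_le.2 hij
      nlinarith [(j.cast_nonneg : (0 : ℝ) ≤ j)]
    have := mul_le_mul_of_nonneg_left hle hji
    simp only [K]
    nlinarith
  have hK (i j : ℕ) : β * (i + j) * min (u i * v j) (u j * v i) ≤ K i j + K j i := by
    have hnn : 0 ≤ β * ((i : ℝ) + j) := by positivity
    rcases le_total i j with hij | hij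
    · exact (mul_le_mul_of_nonneg_left (min_le_left _ _) hnn).trans (hK1 hij)
    · rw [add_comm (K i j), add_comm (i : ℝ)] at *
      exact (mul_le_mul_of_nonneg_left (min_le_right _ _) hnn).trans (hK1 hij)
  have hmin (i j : ℕ) : 0 < min (u i * v j) (u j * v i) :=
    lt_min (mul_pos (hu i) (hv j)) (mul_pos (hu j) (hv i))
  let c (m : ℕ) : ℝ := ∑ p ∈ antidiagonal m, coeff a p.1 * coeff a p.2 * K p.1 p.2
  have hc2 (m : ℕ) : c m + c m =
      ∑ p ∈ antidiagonal m, coeff a p.1 * coeff a p.2 * (K p.1 p.2 + K p.2 p.1) := by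
    have : c m = ∑ p ∈ antidiagonal m, coeff a p.1 * coeff a p.2 * K p.2 p.1 := by
      simp only [c]
      rw [← Finset.Nat.sum_antidiagonal_swap]
      exact Finset.sum_congr rfl fun p _ => by
        simp only [Prod.fst_swap, Prod.snd_swap]
        ring
    nth_rewrite 2 [this]
    rw [← Finset.sum_add_distrib]
    exact Finset.sum_congr rfl fun p _ => by ring
  have hterm (i j : ℕ) : 0 ≤ coeff a i * coeff a j * (K i j + K j i) := by
    refine mul_nonneg (mul_nonneg (hh i) (hh j)) (le_trans ?_ (hK i j))
    have := (hmin i j).le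
    positivity
  have hc (m : ℕ) : 0 ≤ c m := by
    have : 0 ≤ c m + c m := by
      rw [hc2]
      exact Finset.sum_nonneg fun p _ => hterm p.1 p.2
    linarith
  have hc_pos : 0 < c 2 := by
    have : 0 < c 2 + c 2 := by
      rw [hc2]
      -- The pair `(1, 1)` is the lowest-order one with both `h` factors nonzero.
      refine Finset.sum_pos' (fun p _ => hterm p.1 p.2) ⟨(1, 1), mem_antidiagonal.2 rfl, ?_⟩
      refine mul_pos (mul_pos (coeff_succ_pos ha0 0) (coeff_succ_pos ha0 0))
        (lt_of_lt_of_le ?_ (hK 1 1))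
      have := hmin 1 1
      positivity
    linarith
  have hsum (y : ℝ) : HasSum (fun m => c m * y ^ m)
      ((ν + β) * (paramDeriv a ν y * paramDeriv a (ν + β + 1) y)
        - ν * (paramDeriv a (ν + 1) y * paramDeriv a (ν + β) y)) := by
    refine hasSum_of_eq (fun m => ?_) (((hasSum_pow_mul (hasSum_paramDeriv_inv ha ν y)
      (hasSum_paramDeriv_add_one ha (ν + β) y)).mul_left (ν + β)).sub
      ((hasSum_pow_mul (hasSum_paramDeriv_add_one ha ν y)
      (hasSum_paramDeriv_inv ha (ν + β) y)).mul_left ν))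
    rw [← mul_assoc, ← mul_assoc, ← sub_mul, Finset.mul_sum, Finset.mul_sum,
      ← Finset.sum_sub_distrib]
    refine congrArg (· * y ^ m) (Finset.sum_congr rfl fun p _ => ?_)
    rw [hu' p.1, hv' p.2]
    simp only [K, u, v]
    ring
  exact sub_pos.1 (hasSum_pow_pos hc hsum hc_pos hx)

end Coefficients

end RegKummer
-- Assembly of the theorem
theorem mainTheorem11 (a : ℝ) (ha : 1 ≤ a) :
    -- the parameter derivative exists and has the stated series
    (∀ ν x : ℝ, DifferentiableAt ℝ (fun α : ℝ => RegKummer.regKummer α ν x) a ∧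
      HasSum (fun k : ℕ => RegKummer.coeff a k / Real.Gamma (ν + k) * x ^ k)
        (RegKummer.paramDeriv a ν x)) ∧
    -- concavity of `y ↦ ψ(a+y) - ψ(a)` and log-concavity of `h_k`
    ConcaveOn ℝ (Ici 0) (fun y : ℝ => RegKummer.digamma (a + y) - RegKummer.digamma a) ∧
    (RegKummer.coeff a 0 = 0 ∧ ∀ k : ℕ, 0 < RegKummer.coeff a (k + 1) ∧
      RegKummer.coeff a k * RegKummer.coeff a (k + 2) < RegKummer.coeff a (k + 1) ^ 2) ∧
    -- strict discrete Wright log-concavity in the parameter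
    (∀ x : ℝ, 0 < x →
      RegKummer.StrictDiscreteWrightLogConcaveOn (fun ν => RegKummer.paramDeriv a ν x) (Ioi 0)) ∧
    ∀ ν β : ℝ, -1 ≤ ν → 0 < β → 0 ≤ ν + β →
      -- power series coefficients
      (∃ c : ℕ → ℝ, c 0 = 0 ∧ c 1 = 0 ∧ (∀ m : ℕ, 2 ≤ m → 0 < c m) ∧
        ∀ x : ℝ, HasSum (fun m : ℕ => c m * x ^ m) (RegKummer.lam a β ν x)) ∧
      AbsolutelyMonotoneOn (RegKummer.lam a β ν) (Ioi 0) ∧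
      RegKummer.MultiplicativelyConvex (RegKummer.lam a β ν) ∧
      -- complete monotonicity and the integral representation
      RegKummer.CompletelyMonotoneOn (fun y => RegKummer.lam a β ν (1 / y)) (Ioi 0) ∧
      RegKummer.LogConvexOn (fun y => RegKummer.lam a β ν (1 / y)) (Ioi 0) ∧
      (∃ τ : Measure ℝ, τ (Iio 0) = 0 ∧ ∀ x : ℝ, 0 < x →
        Integrable (fun t => Real.exp (-t / x)) τ ∧
          RegKummer.lam a β ν x = ∫ t, Real.exp (-t / x) ∂τ) ∧
      -- two-sided bounds; for `ν + β = 0` the lower bound `ν / (β + ν)` is `-∞`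
      (∀ x : ℝ, 0 < x →
        0 < RegKummer.paramDeriv a (1 + ν) x * RegKummer.paramDeriv a (β + ν) x ∧
        (0 < ν + β → ν / (β + ν) <
          RegKummer.paramDeriv a ν x * RegKummer.paramDeriv a (1 + β + ν) x /
            (RegKummer.paramDeriv a (1 + ν) x * RegKummer.paramDeriv a (β + ν) x)) ∧
        RegKummer.paramDeriv a ν x * RegKummer.paramDeriv a (1 + β + ν) x /
          (RegKummer.paramDeriv a (1 + ν) x * RegKummer.paramDeriv a (β + ν) x) < 1) ∧
      -- lower bound with its case of equality
      (∀ x : ℝ, 0 ≤ x →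
        RegKummer.coeff a 0 ^ 2 * β / (Real.Gamma (ν + 1) * Real.Gamma (ν + β + 1)) ≤
          RegKummer.lam a β ν x ∧
        (RegKummer.lam a β ν x =
          RegKummer.coeff a 0 ^ 2 * β / (Real.Gamma (ν + 1) * Real.Gamma (ν + β + 1)) ↔
            x = 0)) := by
  have ha0 : 0 < a := by linarith
  refine ⟨fun ν x => ⟨(RegKummer.hasDerivAt_regKummer ha ν x).2.differentiableAt,
    RegKummer.hasSum_paramDeriv ha ν x⟩, RegKummer.concaveOn_digamma_sub ha0,
    ⟨RegKummer.coeff_zero a, fun k => ⟨RegKummer.coeff_succ_pos ha0 k,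
      RegKummer.coeff_mul_coeff_lt ha k⟩⟩,
    fun x hx => RegKummer.strictDiscreteWrightLogConcaveOn_paramDeriv ha hx,
    fun ν β hν hβ hνβ => ?_⟩
  obtain ⟨c, h0, h1, h2, hs⟩ := RegKummer.exists_hasSum_lam ha hν hβ
  have hc (m : ℕ) : 0 ≤ c m := by
    match m with
    | 0 => exact h0.ge
    | 1 => exact h1.ge
    | m + 2 => exact (h2 _ (by omega)).le
  have hc2 : 0 < c 2 := h2 2 le_rfl
  have hzero : RegKummer.lam a β ν 0 = 0 := by
    refine (hs 0).unique (RegKummer.hasSum_of_eq (fun m => ?_) hasSum_zero)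
    rcases m with _ | m <;> simp [h0]
  refine ⟨⟨c, h0, h1, h2, hs⟩, RegKummer.absolutelyMonotoneOn_of_hasSum_pow hc hs,
    RegKummer.multiplicativelyConvex_of_hasSum_pow hc hc2 hs,
    RegKummer.completelyMonotoneOn_comp_inv hc hs, RegKummer.logConvexOn_comp_inv hc hc2 hs,
    RegKummer.exists_measure_laplace_of_hasSum_pow hc h0 hs, fun x hx => ?_, fun x hx => ?_⟩
  · rw [add_comm 1 ν, add_comm β ν, show 1 + β + ν = ν + β + 1 by ring]
    have hν0 := RegKummer.paramDeriv_pos ha hν hx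
    have hP : 0 < RegKummer.paramDeriv a (ν + 1) x * RegKummer.paramDeriv a (ν + β) x :=
      mul_pos (RegKummer.paramDeriv_pos ha (by linarith) hx)
        (RegKummer.paramDeriv_pos ha (by linarith) hx)
    have hQ : 0 < RegKummer.paramDeriv a ν x * RegKummer.paramDeriv a (ν + β + 1) x :=
      mul_pos hν0 (RegKummer.paramDeriv_pos ha (by linarith) hx)
    refine ⟨hP, fun hpos => ?_,
      (div_lt_one hP).2 (sub_pos.1 (RegKummer.lam_pos ha hν hβ hx))⟩
    -- For `ν ≤ 0` the lower bound is nonpositive while the quotient is positive; only `ν > 0` needs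
    -- the second symmetrisation.
    rcases le_or_gt ν 0 with hle | hgt
    · exact (div_nonpos_of_nonpos_of_nonneg hle hpos.le).trans_lt (div_pos hQ hP)
    · rw [div_lt_div_iff₀ hpos hP, mul_comm _ (ν + β)]
      exact RegKummer.mul_paramDeriv_mul_paramDeriv_lt ha hgt hβ hx
  · rw [RegKummer.coeff_zero, sq, zero_mul, zero_mul, zero_div]
    rcases hx.eq_or_lt with rfl | hx
    · simp [hzero]
    · have := RegKummer.lam_pos ha hν hβ hx
      exact ⟨this.le, fun h => absurd h this.ne', fun h => absurd h hx.ne'⟩
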